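/- Let $\mathbb H=\{z\in\mathbb C:\operatorname{Im} z>0\}$ and let $\Phi:\mathbb H\to\mathbb H$ be holomorphic with $$A:=\inf_{z\in\mathbb H}\frac{\operatorname{Im}\Phi(z)}{\operatorname{Im} z}>1$$ (that is, $\Phi$ is of hyperbolic type with Denjoy--Wolff point $\infty$). Let $\Phi_n$ be the $n$-th iterate of $\Phi$. For $z_0\in\mathbb H$ write $z_n=\Phi_n(z_0)=x_n+iy_n$ and $\tau_n(z)=(z-x_n)/y_n$. We say that $z\to\infty$ non-tangentially if $z\to\infty$ within a sector $\{z\in\mathbb H:|\operatorname{Arg}z-\pi/2|<\pi/2-\delta\}$ with $\delta>0$; a non-tangential limit at $\infty$ is a limit that holds in every such sector. A map $f:\mathbb H\to\mathbb H$ is called semi-conformal at $\infty$ if $f(z)$ has non-tangential limit $\infty$ at $\infty$ and $\operatorname{Arg}(f(z)/z)$ has non-tangential limit $0$ at $\infty$. Then the following hold. 1. For every $z_0\in\mathbb H$ the limits $\theta(z_0)=\lim_{n\to\infty}\operatorname{Arg} z_n\in(0,\pi)$ and $b_\infty(z_0)=\lim_{n\to\infty}(x_{n+1}-x_n)/y_n\in\mathbb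 R$ exist, $b_\infty(z_0)=(A-1)\cot\theta(z_0)$, and $b_\infty$ depends continuously on $z_0$. 2. For every $z_0\in\mathbb H$ the renormalized iterates $\tau_n\circ\Phi_n$ converge locally uniformly on $\mathbb H$ to a holomorphic map $\sigma:\mathbb H\to\mathbb H$ with $$\sigma\circ\Phi=A\sigma+b_\infty(z_0).$$ The shifted map $\hat\sigma=\sigma+\dfrac{b_\infty(z_0)}{A-1}$ is a holomorphic self-map of $\mathbb H$, is semi-conformal at $\infty$, and satisfies $\hat\sigma\circ\Phi=A\hat\sigma$. Moreover $\theta(z)=\operatorname{Arg}\hat\sigma(z)$ for all $z\in\mathbb H$. 3. For every $\alpha\in(0,\pi)$ there is $z_0\in\mathbb H$ with $\lim_{n\to\infty}\operatorname{Arg}\Phi_n(z_0)=\theta(z_0)=\alpha$. -/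

import Mathlib

/-- The real affine automorphism of the upper half-plane that sends `w` to `i`:
with `w = x + i y` it is `τ(z) = (z - x) / y`. -/
noncomputable def tauMap (w z : ℂ) : ℂ := (z - (w.re : ℂ)) / (w.im : ℂ)

/-- The renormalized iterates `τₙ ∘ Φₙ`, where `Φₙ` is the `n`-th iterate of `Φ` and `τₙ` is the
affine automorphism of the upper half-plane that sends `zₙ = Φₙ(z₀)` to `i`. -/
noncomputable def renormIter (Φ : ℂ → ℂ) (z₀ : ℂ) (n : ℕ) (z : ℂ) : ℂ :=
  tauMap (Φ^[n] z₀) (Φ^[n] z)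

/-- The sector `{z : Im z > 0, |Arg z - π/2| < π/2 - δ}`. -/
def sectorAt (δ : ℝ) : Set ℂ :=
  {z : ℂ | 0 < z.im ∧ |z.arg - Real.pi / 2| < Real.pi / 2 - δ}

/-- Non-tangential limit at infinity in the upper half-plane: `f` tends to `l` as `z → ∞` inside
each sector `sectorAt δ`, `δ > 0`. -/
def KLim {β : Type*} (f : ℂ → β) (l : Filter β) : Prop :=
  ∀ δ : ℝ, 0 < δ →
    Filter.Tendsto f (Bornology.cobounded ℂ ⊓ Filter.principal (sectorAt δ)) l

/-- Semi-conformality at infinity: `f` has non-tangential limit `∞` at `∞`, and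
`Arg (f z / z)` has non-tangential limit `0` at `∞`. -/
def SemiConformalAtInfty (f : ℂ → ℂ) : Prop :=
  KLim f (Bornology.cobounded ℂ) ∧ KLim (fun z => (f z / z).arg) (nhds 0)

/-- A holomorphic self-map of the upper half-plane. -/
def IsHoloSelfMap (f : ℂ → ℂ) : Prop :=
  DifferentiableOn ℂ f UpperHalfPlane.upperHalfPlaneSet ∧
    Set.MapsTo f UpperHalfPlane.upperHalfPlaneSet UpperHalfPlane.upperHalfPlaneSet

/-- `Φ` is a holomorphic self-map of the upper half-plane of hyperbolic type with Denjoy-Wolff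
point at infinity: `A = inf Im Φ(z) / Im z > 1`. -/
def IsHyperbolicSelfMap (Φ : ℂ → ℂ) (A : ℝ) : Prop :=
  IsHoloSelfMap Φ ∧
    IsGLB ((fun z : ℂ => (Φ z).im / z.im) '' UpperHalfPlane.upperHalfPlaneSet) A ∧ 1 < A

open Complex Filter Topology Set
open UpperHalfPlane (upperHalfPlaneSet isOpen_upperHalfPlaneSet)
open scoped ComplexConjugate

/-! Consecutive points of an orbit of `Φ` stay within a bounded hyperbolic distance, while their
imaginary parts grow geometrically because `A > 1`. So orbits tend to `∞` non-tangentially and, by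
the Julia–Wolff–Carathéodory theorem, `Φ^[n+1] / Φ^[n] → A`. By Montel's theorem
`Φ^[n] / Im Φ^[n](i)` has a limit point `h`, and therefore `h ∘ Φ = A h`.

The rescalings `ζ ↦ h (t ζ) / Im h (t i)` form a normal family as `t → ∞`, and by Schwarz–Pick each
of its limit maps fixes both `i` and `A i`, so it is the identity. Hence `h` is non-tangentially
asymptotic to positive real multiples of the identity. Along an orbit `h (Φ^[n] z) = A ^ n h z`,
so `Φ^[n]`, divided by suitable positive numbers, converges to `h`: the angle `θ` is the argument
of `h`, the slope `b` is `(A - 1) Re h / Im h`, and `σ̂` is a positive multiple of `h`.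
-/

/-- The square of `2 sinh (d(a, b) / 2)`, where `d` is the hyperbolic distance of the upper
half-plane. This increasing function of `d` is the form in which `d` is used throughout. -/
noncomputable def hypSq (a b : ℂ) : ℝ := ‖a - b‖ ^ 2 / (a.im * b.im)

/-- The Cayley transform centred at `w`, which maps the upper half-plane onto the unit disc and
`w` to `0`. -/
noncomputable def cayleyAt (w z : ℂ) : ℂ := (z - w) / (z - conj w)

/-- The inverse of the Cayley transform `cayleyAt w`. -/
noncomputable def cayleySymmAt (w ζ : ℂ) : ℂ := (w - conj w * ζ) / (1 - ζ)

section Cayley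

variable {w z : ℂ}

theorem sub_conj_ne_zero (hz : 0 < z.im) (hw : 0 < w.im) : z - conj w ≠ 0 := by
  intro h
  have him := congrArg im h
  simp only [sub_im, conj_im, zero_im] at him
  linarith

theorem norm_sub_conj_sq (z w : ℂ) : ‖z - conj w‖ ^ 2 = ‖z - w‖ ^ 2 + 4 * (z.im * w.im) := by
  simp only [← normSq_eq_norm_sq, normSq_apply, sub_re, sub_im, conj_re, conj_im]
  ring

@[simp] theorem hypSq_self (z : ℂ) : hypSq z z = 0 := by simp [hypSq]

theorem hypSq_nonneg (hz : 0 < z.im) (hw : 0 < w.im) : 0 ≤ hypSq z w :=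
  div_nonneg (sq_nonneg _) (mul_pos hz hw).le

theorem norm_sub_sq_eq_hypSq_mul (hz : 0 < z.im) (hw : 0 < w.im) :
    ‖z - w‖ ^ 2 = hypSq z w * (z.im * w.im) :=
  (div_mul_cancel₀ _ (mul_pos hz hw).ne').symm

theorem norm_cayleyAt_sq (hz : 0 < z.im) (hw : 0 < w.im) :
    ‖cayleyAt w z‖ ^ 2 = hypSq z w / (hypSq z w + 4) := by
  have hzw := mul_pos hz hw
  rw [cayleyAt, norm_div, div_pow, norm_sub_conj_sq, norm_sub_sq_eq_hypSq_mul hz hw, ← add_mul,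
    mul_div_mul_right _ _ hzw.ne']

theorem cayleyAt_mem_ball (hz : 0 < z.im) (hw : 0 < w.im) : cayleyAt w z ∈ Metric.ball 0 1 := by
  have hpos := hypSq_nonneg hz hw
  rw [mem_ball_zero_iff, ← sq_lt_one_iff₀ (norm_nonneg _), norm_cayleyAt_sq hz hw,
    div_lt_one (by positivity)]
  linarith

@[simp] theorem cayleyAt_self (w : ℂ) : cayleyAt w w = 0 := by simp [cayleyAt]

@[simp] theorem cayleySymmAt_zero (w : ℂ) : cayleySymmAt w 0 = w := by simp [cayleySymmAt]

theorem cayleySymmAt_cayleyAt (hz : 0 < z.im) (hw : 0 < w.im) :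
    cayleySymmAt w (cayleyAt w z) = z := by
  have hzw := sub_conj_ne_zero hz hw
  have hww := sub_conj_ne_zero hw hw
  have hsub : 1 - cayleyAt w z = (w - conj w) / (z - conj w) := by
    rw [cayleyAt]; field_simp; ring
  rw [cayleySymmAt, hsub, cayleyAt]
  field_simp
  ring

theorem one_sub_ne_zero_of_mem_ball {ζ : ℂ} (hζ : ζ ∈ Metric.ball (0 : ℂ) 1) : 1 - ζ ≠ 0 := by
  rw [sub_ne_zero]
  rintro rfl
  simp at hζ

theorem cayleySymmAt_im (w ζ : ℂ) :
    (cayleySymmAt w ζ).im = w.im * (1 - ‖ζ‖ ^ 2) / ‖1 - ζ‖ ^ 2 := by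
  simp only [cayleySymmAt, ← normSq_eq_norm_sq, div_im, sub_im, sub_re, mul_re, mul_im, conj_re,
    conj_im, one_re, one_im]
  rw [← sub_div]
  congr 1
  simp only [normSq_apply]
  ring

theorem mapsTo_cayleySymmAt (hw : 0 < w.im) :
    MapsTo (cayleySymmAt w) (Metric.ball 0 1) upperHalfPlaneSet := by
  intro ζ hζ
  have hden : 0 < ‖1 - ζ‖ := norm_pos_iff.2 (one_sub_ne_zero_of_mem_ball hζ)
  have hnum : 0 < 1 - ‖ζ‖ ^ 2 :=
    sub_pos.2 ((sq_lt_one_iff₀ (norm_nonneg _)).2 (mem_ball_zero_iff.1 hζ))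
  change 0 < (cayleySymmAt w ζ).im
  rw [cayleySymmAt_im]
  positivity

theorem differentiableOn_cayleySymmAt (w : ℂ) :
    DifferentiableOn ℂ (cayleySymmAt w) (Metric.ball 0 1) :=
  DifferentiableOn.div (by fun_prop) (by fun_prop) fun _ => one_sub_ne_zero_of_mem_ball

theorem differentiableOn_cayleyAt (hw : 0 < w.im) :
    DifferentiableOn ℂ (cayleyAt w) upperHalfPlaneSet :=
  DifferentiableOn.div (by fun_prop) (by fun_prop) fun _ hz => sub_conj_ne_zero hz hw

end Cayley

namespace IsHoloSelfMap

variable {f g : ℂ → ℂ} {w z : ℂ}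

theorem im_pos (hf : IsHoloSelfMap f) (hz : 0 < z.im) : 0 < (f z).im := hf.2 hz

theorem div_ofReal (hf : IsHoloSelfMap f) {r : ℝ} (hr : 0 < r) :
    IsHoloSelfMap fun z => f z / r := by
  refine ⟨hf.1.div_const _, fun z hz => ?_⟩
  change 0 < (f z / r).im
  rw [div_ofReal_im]
  exact div_pos (hf.im_pos hz) hr

theorem sub_ofReal (hf : IsHoloSelfMap f) (r : ℝ) : IsHoloSelfMap fun z => f z - r := by
  refine ⟨hf.1.sub_const _, fun z hz => ?_⟩
  simpa using hf.im_pos hz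

theorem comp_ofReal_mul (hf : IsHoloSelfMap f) {r : ℝ} (hr : 0 < r) :
    IsHoloSelfMap fun z => f (r * z) := by
  have hmaps : MapsTo (fun z : ℂ => r * z) upperHalfPlaneSet upperHalfPlaneSet := fun z hz => by
    simpa using mul_pos hr hz
  exact ⟨hf.1.comp (by fun_prop) hmaps, hf.2.comp hmaps⟩

theorem iterate (hf : IsHoloSelfMap f) (n : ℕ) : IsHoloSelfMap f^[n] := by
  refine ⟨?_, hf.2.iterate n⟩
  induction n with
  | zero => exact differentiableOn_id
  | succ n ih => exact ih.comp hf.1 hf.2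

section SchwarzPick

/-- A self-map of the upper half-plane read in the discs of `cayleyAt w` and `cayleyAt (f w)`; the
Schwarz lemma applies to it. -/
noncomputable def discConj (f : ℂ → ℂ) (w : ℂ) : ℂ → ℂ :=
  cayleyAt (f w) ∘ f ∘ cayleySymmAt w

theorem differentiableOn_discConj (hf : IsHoloSelfMap f) (hw : 0 < w.im) :
    DifferentiableOn ℂ (discConj f w) (Metric.ball 0 1) :=
  (differentiableOn_cayleyAt (hf.im_pos hw)).comp
    (hf.1.comp (differentiableOn_cayleySymmAt w) (mapsTo_cayleySymmAt hw))
    (hf.2.comp (mapsTo_cayleySymmAt hw))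

theorem mapsTo_discConj (hf : IsHoloSelfMap f) (hw : 0 < w.im) :
    MapsTo (discConj f w) (Metric.ball 0 1) (Metric.closedBall 0 1) := fun _ hζ =>
  Metric.ball_subset_closedBall
    (cayleyAt_mem_ball (hf.2 (mapsTo_cayleySymmAt hw hζ)) (hf.im_pos hw))

theorem discConj_zero (f : ℂ → ℂ) (w : ℂ) : discConj f w 0 = 0 := by simp [discConj]

theorem discConj_cayleyAt (f : ℂ → ℂ) (hz : 0 < z.im) (hw : 0 < w.im) :
    discConj f w (cayleyAt w z) = cayleyAt (f w) (f z) := by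
  simp [discConj, cayleySymmAt_cayleyAt hz hw]

theorem hypSq_map_le (hf : IsHoloSelfMap f) (hz : 0 < z.im) (hw : 0 < w.im) :
    hypSq (f z) (f w) ≤ hypSq z w := by
  have hnorm : ‖cayleyAt (f w) (f z)‖ ≤ ‖cayleyAt w z‖ := by
    rw [← discConj_cayleyAt f hz hw]
    exact norm_le_norm_of_mapsTo_ball (hf.differentiableOn_discConj hw) (hf.mapsTo_discConj hw)
      (discConj_zero f w) (mem_ball_zero_iff.1 (cayleyAt_mem_ball hz hw))
  have hsq := pow_le_pow_left₀ (norm_nonneg _) hnorm 2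
  have h₁ := hypSq_nonneg hz hw
  have h₂ := hypSq_nonneg (hf.im_pos hz) (hf.im_pos hw)
  rw [norm_cayleyAt_sq hz hw, norm_cayleyAt_sq (hf.im_pos hz) (hf.im_pos hw),
    div_le_div_iff₀ (by positivity) (by positivity)] at hsq
  linarith

theorem eqOn_id_of_two_fixedPoints (hf : IsHoloSelfMap f) (hz : 0 < z.im) (hw : 0 < w.im)
    (hzw : z ≠ w) (hfz : f z = z) (hfw : f w = w) : EqOn f id upperHalfPlaneSet := by
  set ζ := cayleyAt w z with hζ
  have hζ₀ : ζ ≠ 0 := div_ne_zero (sub_ne_zero.2 hzw) (sub_conj_ne_zero hz hw)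
  have hslope : dslope (discConj f w) 0 ζ = 1 := by
    rw [dslope_of_ne _ hζ₀, slope_def_field, discConj_zero, hζ, discConj_cayleyAt f hz hw, hfz,
      hfw, sub_zero, ← hζ, div_self hζ₀]
  have hid := affine_of_mapsTo_ball_of_norm_dslope_eq_div (R₂ := 1)
    (hf.differentiableOn_discConj hw) (by simpa [discConj_zero] using hf.mapsTo_discConj hw)
    (cayleyAt_mem_ball hz hw) (by rw [← hζ, hslope]; simp)
  intro x hx
  have hx' : cayleyAt w (f x) = cayleyAt w x := by
    have := hid (cayleyAt_mem_ball hx hw)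
    rw [discConj_cayleyAt f hx hw, ← hζ, hslope, hfw, discConj_zero] at this
    simpa using this
  rw [id, ← cayleySymmAt_cayleyAt (hf.im_pos hx) hw, hx', cayleySymmAt_cayleyAt hx hw]

end SchwarzPick

end IsHoloSelfMap

theorem norm_sub_sq_le {a b : ℂ} (ha : 0 < a.im) (hb : 0 < b.im) :
    ‖a - b‖ ^ 2 ≤ hypSq a b * (hypSq a b + 2) * b.im ^ 2 := by
  have hsq := norm_sub_sq_eq_hypSq_mul ha hb
  have hpos := hypSq_nonneg ha hb
  have him : a.im ≤ b.im + ‖a - b‖ := by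
    have := (le_abs_self _).trans (abs_im_le_norm (a - b))
    rw [sub_im] at this
    linarith
  have hmul := mul_le_mul_of_nonneg_left him (mul_nonneg hpos hb.le)
  nlinarith [sq_nonneg (hypSq a b * b.im - ‖a - b‖)]

theorem norm_sub_le_of_hypSq_le {a b : ℂ} {S : ℝ} (ha : 0 < a.im) (hb : 0 < b.im)
    (h : hypSq a b ≤ S) : ‖a - b‖ ≤ (S + 1) * b.im := by
  have hpos := hypSq_nonneg ha hb
  refine le_of_sq_le_sq ?_ (mul_nonneg (by linarith) hb.le)
  calc ‖a - b‖ ^ 2 ≤ hypSq a b * (hypSq a b + 2) * b.im ^ 2 := norm_sub_sq_le ha hb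
    _ ≤ (S + 1) ^ 2 * b.im ^ 2 := by gcongr; nlinarith
    _ = ((S + 1) * b.im) ^ 2 := by ring

theorem im_le_of_hypSq_le {a b : ℂ} {S : ℝ} (ha : 0 < a.im) (hb : 0 < b.im)
    (h : hypSq a b ≤ S) : a.im ≤ (S + 2) * b.im := by
  have hnorm := norm_sub_le_of_hypSq_le ha hb h
  have him := (le_abs_self _).trans (abs_im_le_norm (a - b))
  rw [sub_im] at him
  linarith

theorem hypSq_comm (a b : ℂ) : hypSq a b = hypSq b a := by
  rw [hypSq, hypSq, norm_sub_rev, mul_comm]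

theorem continuousAt_hypSq_left {a b : ℂ} (ha : 0 < a.im) (hb : 0 < b.im) :
    ContinuousAt (fun z => hypSq z b) a :=
  ContinuousAt.div (by fun_prop) (by fun_prop) (mul_pos ha hb).ne'

/-! ### Locally uniform convergence and normal families -/

namespace IsHoloSelfMap

theorem eventually_forall_norm_sub_le {x : ℂ} {η : ℝ} (hx : 0 < x.im) (hη : 0 < η) :
    ∀ᶠ y in 𝓝 x, ∀ f, IsHoloSelfMap f → ‖f y - f x‖ ≤ η * (f x).im := by
  have hcont : ContinuousAt (fun y => hypSq y x * (hypSq y x + 2)) x :=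
    (continuousAt_hypSq_left hx hx).mul ((continuousAt_hypSq_left hx hx).add_const 2)
  have hsmall : ∀ᶠ y in 𝓝 x, hypSq y x * (hypSq y x + 2) < η ^ 2 :=
    hcont.eventually_lt_const (by simpa using pow_pos hη 2)
  filter_upwards [hsmall, isOpen_upperHalfPlaneSet.mem_nhds hx] with y hy hy₀ f hf
  have hle := hf.hypSq_map_le hy₀ hx
  have hpos := hypSq_nonneg (hf.im_pos hy₀) (hf.im_pos hx)
  refine le_of_sq_le_sq ?_ (mul_pos hη (hf.im_pos hx)).le
  calc ‖f y - f x‖ ^ 2 ≤ hypSq (f y) (f x) * (hypSq (f y) (f x) + 2) * (f x).im ^ 2 :=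
        norm_sub_sq_le (hf.im_pos hy₀) (hf.im_pos hx)
    _ ≤ hypSq y x * (hypSq y x + 2) * (f x).im ^ 2 := by
        have := hpos.trans hle
        gcongr
    _ ≤ (η * (f x).im) ^ 2 := by rw [mul_pow]; gcongr

theorem tendstoLocallyUniformlyOn {ι : Type*} {l : Filter ι} [l.NeBot] {f : ι → ℂ → ℂ} {g : ℂ → ℂ}
    (hf : ∀ᶠ i in l, IsHoloSelfMap (f i))
    (hfg : ∀ z : ℂ, 0 < z.im → Tendsto (fun i => f i z) l (𝓝 (g z))) :
    TendstoLocallyUniformlyOn f g l upperHalfPlaneSet := by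
  rw [Metric.tendstoLocallyUniformlyOn_iff]
  intro ε hε x hx
  have him : Tendsto (fun i => (f i x).im) l (𝓝 (g x).im) :=
    (continuous_im.tendsto _).comp (hfg x hx)
  have him₀ : 0 ≤ (g x).im := ge_of_tendsto him (hf.mono fun i hi => (hi.im_pos hx).le)
  set η := ε / (4 * ((g x).im + 1)) with hη
  have hη₀ : 0 < η := by positivity
  have hηM : η * ((g x).im + 1) = ε / 4 := by rw [hη]; field_simp
  set U := {y | ∀ f, IsHoloSelfMap f → ‖f y - f x‖ ≤ η * (f x).im}
  have hU : U ∩ upperHalfPlaneSet ∈ 𝓝 x :=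
    inter_mem (eventually_forall_norm_sub_le hx hη₀) (isOpen_upperHalfPlaneSet.mem_nhds hx)
  have hlim : ∀ y ∈ U ∩ upperHalfPlaneSet, ‖g y - g x‖ ≤ η * (g x).im := fun y hy =>
    le_of_tendsto_of_tendsto ((hfg y hy.2).sub (hfg x hx)).norm (him.const_mul η)
      (hf.mono fun i hi => hy.1 _ hi)
  refine ⟨_, mem_nhdsWithin_of_mem_nhds hU, ?_⟩
  filter_upwards [hf, him.eventually_lt_const (lt_add_one _),
    Metric.tendsto_nhds.1 (hfg x hx) (ε / 4) (by positivity)] with i hi hiM hix y hy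
  have hgy := hlim y hy
  have hfy := hy.1 _ hi
  calc dist (g y) (f i y) ≤ dist (g y) (g x) + dist (g x) (f i x) + dist (f i x) (f i y) :=
        dist_triangle4 _ _ _ _
    _ < ε := by
        rw [dist_comm (g x), dist_comm (f i x) (f i y), dist_eq_norm, dist_eq_norm (f i y)]
        nlinarith

end IsHoloSelfMap

/-- The points `z i / t i` eventually stay in a compact subset of the upper half-plane. For
`t → ∞` this says that `z` tends to `∞` non-tangentially, at the scale `t`. -/
def IsNontangential {ι : Type*} (l : Filter ι) (z : ι → ℂ) (t : ι → ℝ) : Prop :=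
  ∃ C > 0, ∀ᶠ i in l, ‖z i‖ ≤ C * t i ∧ t i ≤ C * (z i).im

theorem isNontangential_of_tendsto {ι : Type*} {l : Filter ι} {z : ι → ℂ} {t : ι → ℝ} {ζ : ℂ}
    (hζ : 0 < ζ.im) (ht : ∀ᶠ i in l, 0 < t i) (hz : Tendsto (fun i => z i / t i) l (𝓝 ζ)) :
    IsNontangential l z t := by
  have him : Tendsto (fun i => (z i / t i).im) l (𝓝 ζ.im) := (continuous_im.tendsto _).comp hz
  refine ⟨max (‖ζ‖ + 1) (2 / ζ.im), by positivity, ?_⟩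
  filter_upwards [ht, hz.norm.eventually_le_const (lt_add_one _),
    him.eventually_const_le (half_lt_self hζ)] with i hti hnorm him
  rw [norm_div, norm_real, Real.norm_of_nonneg hti.le, div_le_iff₀ hti] at hnorm
  rw [div_ofReal_im, le_div_iff₀ hti] at him
  have : 0 < (z i).im := lt_of_lt_of_le (by positivity) him
  constructor
  · exact hnorm.trans (by gcongr; exact le_max_left _ _)
  · calc t i = 2 / ζ.im * (ζ.im / 2 * t i) := by field_simp
      _ ≤ max (‖ζ‖ + 1) (2 / ζ.im) * (z i).im := by gcongr; exact le_max_right _ _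

namespace IsNontangential

variable {ι κ : Type*} {l : Filter ι} {z w : ι → ℂ} {t : ι → ℝ} {S : ℝ}

theorem comp_tendsto {l' : Filter κ} {u : κ → ι} (hz : IsNontangential l z t)
    (hu : Tendsto u l' l) : IsNontangential l' (z ∘ u) (t ∘ u) :=
  let ⟨C, hC, h⟩ := hz
  ⟨C, hC, hu.eventually h⟩

theorem mono {l' : Filter ι} (hz : IsNontangential l z t) (hl : l' ≤ l) :
    IsNontangential l' z t :=
  hz.comp_tendsto (tendsto_id'.2 hl)

theorem of_scale_le {s : ι → ℝ} {K : ℝ} (hz : IsNontangential l z s) (hs : ∀ᶠ i in l, 0 < s i)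
    (hst : ∀ᶠ i in l, s i ≤ t i) (hts : ∀ᶠ i in l, t i ≤ K * s i) : IsNontangential l z t := by
  obtain ⟨C, hC, h⟩ := hz
  refine ⟨C * max K 1, by positivity, ?_⟩
  filter_upwards [h, hs, hst, hts] with i ⟨hnorm, him⟩ hsi hst hts
  have hti : 0 < t i := hsi.trans_le hst
  constructor
  · calc ‖z i‖ ≤ C * s i := hnorm
      _ ≤ C * 1 * t i := by rw [mul_one]; gcongr
      _ ≤ C * max K 1 * t i := by gcongr; exact le_max_right _ _
  · calc t i ≤ K * s i := hts
      _ ≤ max K 1 * (C * (z i).im) := by gcongr; exact le_max_left _ _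
      _ = C * max K 1 * (z i).im := by ring

theorem of_hypSq_le (hz : IsNontangential l z t) (ht : ∀ᶠ i in l, 0 < t i)
    (hw : ∀ᶠ i in l, 0 < (w i).im) (hzw : ∀ᶠ i in l, hypSq (w i) (z i) ≤ S) :
    IsNontangential l w t := by
  obtain ⟨C, hC, h⟩ := hz
  refine ⟨C * (|S| + 2), by positivity, ?_⟩
  filter_upwards [h, ht, hw, hzw] with i ⟨hnorm, him⟩ hti hwi hS
  have hzi : 0 < (z i).im := pos_of_mul_pos_right (hti.trans_le him) hC.le
  replace hS := hS.trans (le_abs_self S)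
  have hwz := norm_sub_le_of_hypSq_le hwi hzi hS
  have him' : (z i).im ≤ (|S| + 2) * (w i).im :=
    im_le_of_hypSq_le hzi hwi (hypSq_comm (z i) (w i) ▸ hS)
  constructor
  · calc ‖w i‖ ≤ ‖w i - z i‖ + ‖z i‖ := norm_le_norm_sub_add _ _
      _ ≤ (|S| + 1) * ‖z i‖ + ‖z i‖ := by
          gcongr
          exact hwz.trans (by gcongr; exact (le_abs_self _).trans (abs_im_le_norm _))
      _ = (|S| + 2) * ‖z i‖ := by ring
      _ ≤ (|S| + 2) * (C * t i) := by gcongr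
      _ = C * (|S| + 2) * t i := by ring
  · calc t i ≤ C * (z i).im := him
      _ ≤ C * ((|S| + 2) * (w i).im) := by gcongr
      _ = C * (|S| + 2) * (w i).im := by ring

theorem exists_norm_le_mul_im (hz : IsNontangential l z t) (ht : ∀ᶠ i in l, 0 < t i) :
    ∃ K, ∀ᶠ i in l, 0 < (z i).im ∧ ‖z i‖ ≤ K * (z i).im := by
  obtain ⟨C, hC, h⟩ := hz
  refine ⟨C * C, ?_⟩
  filter_upwards [h, ht] with i ⟨hnorm, him⟩ hti
  refine ⟨pos_of_mul_pos_right (hti.trans_le him) hC.le, ?_⟩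
  calc ‖z i‖ ≤ C * t i := hnorm
    _ ≤ C * (C * (z i).im) := by gcongr
    _ = C * C * (z i).im := by ring

theorem exists_hypSq_le (hz : IsNontangential l z t) (hw : IsNontangential l w t)
    (ht : ∀ᶠ i in l, 0 < t i) : ∃ S, ∀ᶠ i in l, hypSq (w i) (z i) ≤ S := by
  obtain ⟨C, hC, hz⟩ := hz
  obtain ⟨D, hD, hw⟩ := hw
  refine ⟨(D + C) ^ 2 * (D * C), ?_⟩
  filter_upwards [hz, hw, ht] with i ⟨hz₁, hz₂⟩ ⟨hw₁, hw₂⟩ hti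
  have hzi : 0 < (z i).im := pos_of_mul_pos_right (hti.trans_le hz₂) hC.le
  have hwi : 0 < (w i).im := pos_of_mul_pos_right (hti.trans_le hw₂) hD.le
  rw [hypSq, div_le_iff₀ (by positivity)]
  calc ‖w i - z i‖ ^ 2 ≤ ((D + C) * t i) ^ 2 := by
        gcongr
        linarith [norm_sub_le (w i) (z i)]
    _ = (D + C) ^ 2 * (t i * t i) := by ring
    _ ≤ (D + C) ^ 2 * (D * (w i).im * (C * (z i).im)) := by gcongr
    _ = (D + C) ^ 2 * (D * C) * ((w i).im * (z i).im) := by ring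

theorem tendsto_norm_atTop (hz : IsNontangential l z t) (ht : Tendsto t l atTop) :
    Tendsto (fun i => ‖z i‖) l atTop := by
  obtain ⟨C, hC, h⟩ := hz
  refine tendsto_atTop_mono' l ?_ (ht.atTop_div_const hC)
  filter_upwards [h] with i ⟨_, him⟩
  rw [div_le_iff₀' hC]
  exact him.trans (by gcongr; exact (le_abs_self _).trans (abs_im_le_norm _))

theorem exists_tendsto_div {f : Ultrafilter ι} (hz : IsNontangential f z t)
    (ht : ∀ᶠ i in f, 0 < t i) :
    ∃ ζ : ℂ, 0 < ζ.im ∧ Tendsto (fun i => z i / t i) f (𝓝 ζ) := by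
  obtain ⟨C, hC, h⟩ := hz
  have hK : IsCompact (Metric.closedBall (0 : ℂ) C ∩ {ζ | C⁻¹ ≤ ζ.im}) :=
    (isCompact_closedBall 0 C).inter_right (isClosed_le continuous_const continuous_im)
  have hmem : ∀ᶠ i in f, z i / t i ∈ Metric.closedBall (0 : ℂ) C ∩ {ζ | C⁻¹ ≤ ζ.im} := by
    filter_upwards [h, ht] with i ⟨hnorm, him⟩ hti
    constructor
    · rw [mem_closedBall_zero_iff, norm_div, norm_real, Real.norm_of_nonneg hti.le]
      exact (div_le_iff₀ hti).2 hnorm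
    · change C⁻¹ ≤ (z i / t i).im
      rw [div_ofReal_im, le_div_iff₀ hti]
      exact (inv_mul_le_iff₀ hC).2 him
  obtain ⟨ζ, hζ, hlim⟩ := hK.ultrafilter_le_nhds (f.map fun i => z i / t i)
    (le_principal_iff.2 hmem)
  exact ⟨ζ, (inv_pos.2 hC).trans_le hζ.2, hlim⟩

end IsNontangential

theorem exists_isHoloSelfMap_tendsto {ι : Type*} {f : Ultrafilter ι} {g : ι → ℂ → ℂ} {w w₀ : ℂ}
    (hg : ∀ᶠ i in f, IsHoloSelfMap (g i)) (hw : 0 < w.im) (hw₀ : 0 < w₀.im)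
    (hgw : Tendsto (fun i => g i w) f (𝓝 w₀)) :
    ∃ G, IsHoloSelfMap G ∧ ∀ z : ℂ, 0 < z.im → Tendsto (fun i => g i z) f (𝓝 (G z)) := by
  have hlim : ∀ z : ℂ, 0 < z.im → ∃ ζ : ℂ, 0 < ζ.im ∧ Tendsto (fun i => g i z) f (𝓝 ζ) := by
    intro z hz
    have hone : ∀ᶠ _ in (f : Filter ι), (0 : ℝ) < 1 := .of_forall fun _ => one_pos
    have hwnt : IsNontangential f (fun i => g i w) 1 :=
      isNontangential_of_tendsto hw₀ hone (by simpa using hgw)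
    have hznt : IsNontangential f (fun i => g i z) 1 :=
      hwnt.of_hypSq_le hone (hg.mono fun i hi => hi.im_pos hz)
        (hg.mono fun i hi => hi.hypSq_map_le hz hw)
    simpa using hznt.exists_tendsto_div hone
  choose! G hGpos hG using hlim
  refine ⟨G, ⟨?_, fun z hz => hGpos z hz⟩, hG⟩
  exact (IsHoloSelfMap.tendstoLocallyUniformlyOn hg hG).differentiableOn
    (hg.mono fun i hi => hi.1) isOpen_upperHalfPlaneSet

/-! ### The angular derivative at infinity -/

theorem norm_sub_sq_div_im_le {z w : ℂ} {K : ℝ} (hz : 0 < z.im) (hzK : ‖z‖ ≤ K * z.im)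
    (hwz : ‖w‖ ≤ ‖z‖) : ‖z - w‖ ^ 2 / z.im ≤ 4 * K * ‖z‖ := by
  rw [div_le_iff₀ hz]
  calc ‖z - w‖ ^ 2 ≤ (‖z‖ + ‖z‖) ^ 2 := by
        gcongr
        exact (norm_sub_le _ _).trans (by gcongr)
    _ = 4 * ‖z‖ * ‖z‖ := by ring
    _ ≤ 4 * ‖z‖ * (K * z.im) := by gcongr
    _ = 4 * K * ‖z‖ * z.im := by ring

theorem mul_im_le_of_isGLB {Φ : ℂ → ℂ} {A : ℝ}
    (hA : IsGLB ((fun z : ℂ => (Φ z).im / z.im) '' upperHalfPlaneSet) A) {z : ℂ} (hz : 0 < z.im) :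
    A * z.im ≤ (Φ z).im :=
  (le_div_iff₀ hz).1 (hA.1 (mem_image_of_mem _ hz))

namespace IsHoloSelfMap

theorem norm_le_two_mul_norm_add {f : ℂ → ℂ} {ε : ℝ} {z w : ℂ} (hf : IsHoloSelfMap f)
    (hz : 0 < z.im) (hw : 0 < w.im) (hfw : (f w).im ≤ ε * w.im) :
    ‖f z‖ ≤ 2 * ‖f w‖ + ε * (‖z - w‖ ^ 2 / z.im) := by
  have hfz := hf.im_pos hz
  have hfw₀ := hf.im_pos hw
  have hε : 0 ≤ ε := (pos_of_mul_pos_left (hfw₀.trans_le hfw) hw.le).le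
  set D := ‖f z - f w‖
  set Q := ε * (‖z - w‖ ^ 2 / z.im) with hQ
  have : 0 ≤ Q := by positivity
  have him : (f z).im ≤ D + ‖f w‖ :=
    ((le_abs_self _).trans (abs_im_le_norm _)).trans (norm_le_norm_sub_add _ _)
  have hsq : D ^ 2 ≤ Q * (D + ‖f w‖) :=
    calc D ^ 2 = hypSq (f z) (f w) * ((f z).im * (f w).im) := norm_sub_sq_eq_hypSq_mul hfz hfw₀
      _ ≤ hypSq z w * ((D + ‖f w‖) * (ε * w.im)) := by
          have := hf.hypSq_map_le hz hw
          have := hypSq_nonneg hz hw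
          gcongr
      _ = Q * (D + ‖f w‖) := by rw [hypSq, hQ]; field_simp
  have hD : D ≤ Q + ‖f w‖ := by
    by_contra! hlt
    nlinarith [norm_nonneg (f w)]
  linarith [norm_le_norm_sub_add (f z) (f w)]

variable {Φ : ℂ → ℂ} {A : ℝ}

theorem exists_norm_sub_mul_le (hΦ : IsHoloSelfMap Φ)
    (hA : IsGLB ((fun z : ℂ => (Φ z).im / z.im) '' upperHalfPlaneSet) A) {ε : ℝ} (hε : 0 < ε) :
    ∃ (w : ℂ) (B : ℝ), ∀ z : ℂ, 0 < z.im →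
      ‖Φ z - A * z‖ ≤ ε * ‖z‖ + B + ε * (‖z - w‖ ^ 2 / z.im) := by
  obtain ⟨_, ⟨w, hw, rfl⟩, hwA⟩ := hA.exists_between (lt_add_of_pos_right A (half_pos hε))
  rw [div_lt_iff₀ hw] at hwA
  set P : ℂ → ℂ := fun z => Φ z - (A - ε / 2 : ℝ) * z with hP
  have hPim : ∀ z, (P z).im = (Φ z).im - (A - ε / 2) * z.im := fun z => by
    rw [hP, sub_im, im_ofReal_mul]
  have hPself : IsHoloSelfMap P := by
    refine ⟨hΦ.1.sub (by fun_prop), fun z hz => ?_⟩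
    change 0 < (P z).im
    rw [hPim]
    nlinarith [mul_im_le_of_isGLB hA hz, mul_pos hε hz]
  refine ⟨w, 2 * ‖P w‖, fun z hz => ?_⟩
  have hPz := hPself.norm_le_two_mul_norm_add (ε := ε) hz hw (by rw [hPim]; linarith)
  have heq : Φ z - A * z = P z - (ε / 2 : ℝ) * z := by rw [hP]; push_cast; ring
  calc ‖Φ z - A * z‖ ≤ ‖P z‖ + ε / 2 * ‖z‖ := by
        rw [heq]
        refine (norm_sub_le _ _).trans_eq ?_
        rw [norm_mul, norm_real, Real.norm_of_nonneg (half_pos hε).le]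
    _ ≤ ε * ‖z‖ + 2 * ‖P w‖ + ε * (‖z - w‖ ^ 2 / z.im) := by
        linarith [mul_nonneg hε.le (norm_nonneg z)]

theorem tendsto_div_self (hΦ : IsHoloSelfMap Φ)
    (hA : IsGLB ((fun z : ℂ => (Φ z).im / z.im) '' upperHalfPlaneSet) A)
    {ι : Type*} {l : Filter ι} {z : ι → ℂ} {t : ι → ℝ} (hz : IsNontangential l z t)
    (ht : Tendsto t l atTop) : Tendsto (fun i => Φ (z i) / z i) l (𝓝 A) := by
  have hnorm := hz.tendsto_norm_atTop ht
  obtain ⟨K, hK⟩ := hz.exists_norm_le_mul_im (ht.eventually_gt_atTop 0)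
  have hlittle : (fun i => Φ (z i) - A * z i) =o[l] z := by
    rw [Asymptotics.isLittleO_iff]
    intro c hc
    set ε := c / (2 + 4 * |K|) with hε
    obtain ⟨w, B, hB⟩ := hΦ.exists_norm_sub_mul_le hA (ε := ε) (by positivity)
    filter_upwards [hK, hnorm.eventually_ge_atTop (B / ε), hnorm.eventually_ge_atTop ‖w‖]
      with i ⟨hzi, hKi⟩ hBi hwi
    rw [div_le_iff₀' (by positivity)] at hBi
    replace hKi : ‖z i‖ ≤ |K| * (z i).im := hKi.trans (by gcongr; exact le_abs_self K)
    calc ‖Φ (z i) - A * z i‖ ≤ ε * ‖z i‖ + B + ε * (‖z i - w‖ ^ 2 / (z i).im) := hB _ hzi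
      _ ≤ ε * ‖z i‖ + ε * ‖z i‖ + ε * (4 * |K| * ‖z i‖) := by
          gcongr
          exact norm_sub_sq_div_im_le hzi hKi hwi
      _ = c * ‖z i‖ := by rw [hε]; field_simp; ring
  have hne : ∀ᶠ i in l, z i ≠ 0 :=
    (hnorm.eventually_gt_atTop 0).mono fun i hi => norm_pos_iff.1 hi
  have hadd := hlittle.tendsto_div_nhds_zero.add_const (A : ℂ)
  rw [zero_add] at hadd
  refine hadd.congr' (hne.mono fun i hi => ?_)
  field_simp
  ring

end IsHoloSelfMap

/-! ### Orbits -/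

namespace IsHyperbolicSelfMap

variable {Φ : ℂ → ℂ} {A : ℝ} {z w : ℂ}

theorem pos (hΦ : IsHyperbolicSelfMap Φ A) : 0 < A := zero_lt_one.trans hΦ.2.2

theorem mul_im_le (hΦ : IsHyperbolicSelfMap Φ A) (hz : 0 < z.im) : A * z.im ≤ (Φ z).im :=
  mul_im_le_of_isGLB hΦ.2.1 hz

theorem tendsto_div_self (hΦ : IsHyperbolicSelfMap Φ A) {ι : Type*} {l : Filter ι} {z : ι → ℂ}
    {t : ι → ℝ} (hz : IsNontangential l z t) (ht : Tendsto t l atTop) :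
    Tendsto (fun i => Φ (z i) / z i) l (𝓝 A) :=
  hΦ.1.tendsto_div_self hΦ.2.1 hz ht

theorem iterate_im_pos (hΦ : IsHyperbolicSelfMap Φ A) (hz : 0 < z.im) (n : ℕ) :
    0 < (Φ^[n] z).im :=
  (hΦ.1.iterate n).im_pos hz

theorem mul_iterate_im_le (hΦ : IsHyperbolicSelfMap Φ A) (hz : 0 < z.im) (n : ℕ) :
    A * (Φ^[n] z).im ≤ (Φ^[n + 1] z).im := by
  rw [Function.iterate_succ_apply']
  exact hΦ.mul_im_le (hΦ.iterate_im_pos hz n)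

theorem monotone_iterate_im (hΦ : IsHyperbolicSelfMap Φ A) (hz : 0 < z.im) :
    Monotone fun n => (Φ^[n] z).im :=
  monotone_nat_of_le_succ fun n =>
    (le_mul_of_one_le_left (hΦ.iterate_im_pos hz n).le hΦ.2.2.le).trans (hΦ.mul_iterate_im_le hz n)

theorem tendsto_iterate_im (hΦ : IsHyperbolicSelfMap Φ A) (hz : 0 < z.im) :
    Tendsto (fun n => (Φ^[n] z).im) atTop atTop := by
  have hpow : ∀ n, A ^ n * z.im ≤ (Φ^[n] z).im := by
    intro n
    induction n with
    | zero => simp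
    | succ n ih =>
      calc A ^ (n + 1) * z.im = A * (A ^ n * z.im) := by ring
        _ ≤ A * (Φ^[n] z).im := mul_le_mul_of_nonneg_left ih hΦ.pos.le
        _ ≤ (Φ^[n + 1] z).im := hΦ.mul_iterate_im_le hz n
  exact tendsto_atTop_mono hpow ((tendsto_pow_atTop_atTop_of_one_lt hΦ.2.2).atTop_mul_const hz)

theorem exists_norm_iterate_le (hΦ : IsHyperbolicSelfMap Φ A) (hz : 0 < z.im) :
    ∃ C, ∀ n, ‖Φ^[n] z‖ ≤ C * (Φ^[n] z).im := by
  set M := hypSq (Φ z) z + 1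
  have hA : 0 < A - 1 := sub_pos.2 hΦ.2.2
  have hstep : ∀ n, ‖Φ^[n + 1] z - Φ^[n] z‖ ≤ M * (Φ^[n] z).im := fun n =>
    norm_sub_le_of_hypSq_le (hΦ.iterate_im_pos hz _) (hΦ.iterate_im_pos hz _)
      ((hΦ.1.iterate n).hypSq_map_le (hΦ.1.im_pos hz) hz)
  set C := max (‖z‖ / z.im) (M / (A - 1))
  have : 0 ≤ C := (by positivity : 0 ≤ ‖z‖ / z.im).trans (le_max_left _ _)
  have hMC : M ≤ C * (A - 1) := (div_le_iff₀ hA).1 (le_max_right _ _)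
  refine ⟨C, fun n => ?_⟩
  induction n with
  | zero => exact (div_le_iff₀ hz).1 (le_max_left _ _)
  | succ n ih =>
    have hyn := hΦ.iterate_im_pos hz n
    calc ‖Φ^[n + 1] z‖ ≤ ‖Φ^[n + 1] z - Φ^[n] z‖ + ‖Φ^[n] z‖ := norm_le_norm_sub_add _ _
      _ ≤ C * (A - 1) * (Φ^[n] z).im + C * (Φ^[n] z).im := by
          gcongr
          exact (hstep n).trans (by gcongr)
      _ = C * (A * (Φ^[n] z).im) := by ring
      _ ≤ C * (Φ^[n + 1] z).im := by
          gcongr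
          exact hΦ.mul_iterate_im_le hz n

theorem isNontangential_iterate (hΦ : IsHyperbolicSelfMap Φ A) (hz : 0 < z.im) (hw : 0 < w.im) :
    IsNontangential atTop (fun n => Φ^[n] z) fun n => (Φ^[n] w).im := by
  obtain ⟨C, hC⟩ := hΦ.exists_norm_iterate_le hw
  have hwnt : IsNontangential atTop (fun n => Φ^[n] w) fun n => (Φ^[n] w).im := by
    refine ⟨max C 1, by positivity, .of_forall fun n => ?_⟩
    have hyn := hΦ.iterate_im_pos hw n
    exact ⟨(hC n).trans (by gcongr; exact le_max_left _ _),
      le_mul_of_one_le_left hyn.le (le_max_right _ _)⟩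
  exact hwnt.of_hypSq_le (.of_forall (hΦ.iterate_im_pos hw)) (.of_forall (hΦ.iterate_im_pos hz))
    (.of_forall fun n => (hΦ.1.iterate n).hypSq_map_le hz hw)

theorem tendsto_iterate_succ_div (hΦ : IsHyperbolicSelfMap Φ A) (hz : 0 < z.im) :
    Tendsto (fun n => Φ^[n + 1] z / Φ^[n] z) atTop (𝓝 A) := by
  simpa only [Function.iterate_succ_apply'] using
    hΦ.tendsto_div_self (hΦ.isNontangential_iterate hz hz) (hΦ.tendsto_iterate_im hz)

end IsHyperbolicSelfMap

/-! ### Valiron maps -/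

/-- A *Valiron map* of `Φ`: a self-map of the upper half-plane that conjugates `Φ` to
multiplication by `A`. The map `σ̂` of the theorem is one. -/
def IsValironMap (Φ : ℂ → ℂ) (A : ℝ) (h : ℂ → ℂ) : Prop :=
  IsHoloSelfMap h ∧ ∀ z : ℂ, 0 < z.im → h (Φ z) = A * h z

/-- A limit point of the iterates `Φ^[n]` divided by `Im Φ^[n](i)` is a Valiron map, because
`Φ^[n+1] / Φ^[n] → A`. -/
theorem IsHyperbolicSelfMap.exists_isValironMap {Φ : ℂ → ℂ} {A : ℝ}
    (hΦ : IsHyperbolicSelfMap Φ A) : ∃ h, IsValironMap Φ A h := by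
  have hI : 0 < I.im := by simp
  set t : ℕ → ℝ := fun n => (Φ^[n] I).im
  have ht : ∀ n, 0 < t n := hΦ.iterate_im_pos hI
  let f : Ultrafilter ℕ := hyperfilter ℕ
  have hf : (f : Filter ℕ) ≤ atTop := Nat.hyperfilter_le_atTop
  obtain ⟨ζ, hζ, hlim⟩ := ((hΦ.isNontangential_iterate hI hI).mono hf).exists_tendsto_div
    (.of_forall ht)
  obtain ⟨h, hh, hconv⟩ := exists_isHoloSelfMap_tendsto (g := fun n z => Φ^[n] z / t n)
    (.of_forall fun n => (hΦ.1.iterate n).div_ofReal (ht n)) hI hζ hlim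
  refine ⟨h, hh, fun z hz => tendsto_nhds_unique (hconv _ (hΦ.1.im_pos hz)) ?_⟩
  refine (((hΦ.tendsto_iterate_succ_div hz).mono_left hf).mul (hconv z hz)).congr fun n => ?_
  have hne : Φ^[n] z ≠ 0 := fun h0 => (hΦ.iterate_im_pos hz n).ne' (by simp [h0])
  rw [← Function.iterate_succ_apply, div_mul_div_cancel₀ hne]

namespace IsValironMap

variable {Φ h : ℂ → ℂ} {A : ℝ} {z w : ℂ}

theorem im_pos (hh : IsValironMap Φ A h) (hz : 0 < z.im) : 0 < (h z).im := hh.1.im_pos hz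

theorem ne_zero (hh : IsValironMap Φ A h) (hz : 0 < z.im) : h z ≠ 0 := fun h0 =>
  (hh.im_pos hz).ne' (by simp [h0])

theorem div_ofReal (hh : IsValironMap Φ A h) {r : ℝ} (hr : 0 < r) :
    IsValironMap Φ A fun z => h z / r :=
  ⟨hh.1.div_ofReal hr, fun z hz => by simp only [hh.2 z hz, mul_div_assoc]⟩

theorem map_iterate (hh : IsValironMap Φ A h) (hΦ : IsHoloSelfMap Φ) (hz : 0 < z.im) (n : ℕ) :
    h (Φ^[n] z) = A ^ n * h z := by
  induction n with
  | zero => simp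
  | succ n ih =>
    rw [Function.iterate_succ_apply', hh.2 _ ((hΦ.iterate n).im_pos hz), ih, pow_succ']
    ring

end IsValironMap

/-! ### Rigidity at infinity -/

theorem hypSq_ofReal_mul_self {A : ℝ} {u : ℂ} (hu : 0 < u.im) :
    hypSq (A * u) u = (A - 1) ^ 2 / A * (1 + (u.re / u.im) ^ 2) := by
  have hnorm : ‖A * u - u‖ ^ 2 = (A - 1) ^ 2 * (u.re ^ 2 + u.im ^ 2) := by
    simp only [← normSq_eq_norm_sq, normSq_apply, sub_re, sub_im, re_ofReal_mul, im_ofReal_mul]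
    ring
  rw [hypSq, hnorm, im_ofReal_mul]
  field_simp
  ring

theorem hypSq_ofReal_mul_ofReal_mul {r : ℝ} (hr : 0 < r) (z w : ℂ) :
    hypSq (r * z) (r * w) = hypSq z w := by
  rw [hypSq, hypSq, ← mul_sub, norm_mul, norm_real, Real.norm_of_nonneg hr.le, im_ofReal_mul,
    im_ofReal_mul]
  field_simp

theorem isNontangential_ofReal_mul_I {ι : Type*} {l : Filter ι} {t : ι → ℝ}
    (ht : ∀ᶠ i in l, 0 < t i) : IsNontangential l (fun i => t i * I) t :=
  ⟨1, one_pos, ht.mono fun i hi => by simp [abs_of_pos hi]⟩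

section Rigidity

variable {Φ h : ℂ → ℂ} {A : ℝ} {ι : Type*} {l : Filter ι} {z ζ : ι → ℂ} {t : ι → ℝ} {ζ₀ : ℂ}

theorem IsHyperbolicSelfMap.tendsto_mul_I_div (hΦ : IsHyperbolicSelfMap Φ A)
    (ht : Tendsto t l atTop) : Tendsto (fun i => Φ (t i * I) / t i) l (𝓝 (A * I)) := by
  refine ((hΦ.tendsto_div_self (isNontangential_ofReal_mul_I (ht.eventually_gt_atTop 0))
    ht).mul_const I).congr fun i => ?_
  rw [div_mul_eq_mul_div, mul_div_mul_right _ _ I_ne_zero]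

namespace IsValironMap

/-- The hyperbolic step `d(Φ w, w)` at `w = t i` tends to `log A`, the least possible step of
multiplication by `A`, and that is attained only on the imaginary axis. -/
theorem tendsto_re_div_im (hh : IsValironMap Φ A h) (hΦ : IsHyperbolicSelfMap Φ A)
    (ht : Tendsto t l atTop) :
    Tendsto (fun i => (h (t i * I)).re / (h (t i * I)).im) l (𝓝 0) := by
  have hA := hΦ.pos
  have hA₁ : A - 1 ≠ 0 := (sub_pos.2 hΦ.2.2).ne'
  set c := (A - 1) ^ 2 / A with hc
  have hc₀ : 0 < c := by positivity
  have hstep : Tendsto (fun i => hypSq (Φ (t i * I) / t i) I) l (𝓝 c) := by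
    have hAI : hypSq (A * I) I = c := by rw [hypSq_ofReal_mul_self (by simp)]; simp [hc]
    rw [← hAI]
    exact (continuousAt_hypSq_left (by simpa) (by simp)).tendsto.comp (hΦ.tendsto_mul_I_div ht)
  have hsq : Tendsto (fun i => hypSq (Φ (t i * I) / t i) I / c - 1) l (𝓝 0) := by
    simpa [hc₀.ne'] using (hstep.div_const c).sub_const 1
  have hbound : ∀ᶠ i in l, ((h (t i * I)).re / (h (t i * I)).im) ^ 2 ≤
      hypSq (Φ (t i * I) / t i) I / c - 1 := by
    filter_upwards [ht.eventually_gt_atTop 0] with i hti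
    have him : 0 < (t i * I).im := by simpa
    have hscale : hypSq (Φ (t i * I) / t i) I = hypSq (Φ (t i * I)) (t i * I) := by
      rw [← hypSq_ofReal_mul_ofReal_mul hti, mul_div_cancel₀ _ (ofReal_ne_zero.2 hti.ne')]
    have hle := hh.1.hypSq_map_le (hΦ.1.im_pos him) him
    rw [hh.2 _ him, hypSq_ofReal_mul_self (hh.im_pos him), ← hscale] at hle
    rw [le_sub_iff_add_le', le_div_iff₀' hc₀]
    exact hle
  refine squeeze_zero_norm' (hbound.mono fun i hi => Real.abs_le_sqrt hi) ?_
  simpa using hsq.sqrt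

theorem tendsto_mul_I_div_im (hh : IsValironMap Φ A h) (hΦ : IsHyperbolicSelfMap Φ A)
    (ht : Tendsto t l atTop) : Tendsto (fun i => h (t i * I) / (h (t i * I)).im) l (𝓝 I) := by
  have hlim := (((continuous_ofReal.tendsto 0).comp (hh.tendsto_re_div_im hΦ ht)).add_const I)
  rw [ofReal_zero, zero_add] at hlim
  refine hlim.congr' ?_
  filter_upwards [ht.eventually_gt_atTop 0] with i hti
  have him : ((h (t i * I)).im : ℂ) ≠ 0 := ofReal_ne_zero.2 (hh.im_pos (by simpa)).ne'
  rw [Function.comp_apply, ofReal_div, eq_div_iff him, add_mul, div_mul_cancel₀ _ him, mul_comm I,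
    re_add_im]

theorem eventually_isHoloSelfMap_rescale (hh : IsValironMap Φ A h) (ht : Tendsto t l atTop) :
    ∀ᶠ i in l, IsHoloSelfMap fun ζ => h (t i * ζ) / (h (t i * I)).im := by
  filter_upwards [ht.eventually_gt_atTop 0] with i hti
  exact (hh.1.comp_ofReal_mul hti).div_ofReal (hh.im_pos (by simpa))

/-- Any limit map of the rescalings fixes `I` and `A * I`, the limit of `Φ (t i * I) / t i`. -/
theorem tendsto_rescale (hh : IsValironMap Φ A h) (hΦ : IsHyperbolicSelfMap Φ A)
    (ht : Tendsto t l atTop) (hζ₀ : 0 < ζ₀.im) :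
    Tendsto (fun i => h (t i * ζ₀) / (h (t i * I)).im) l (𝓝 ζ₀) := by
  have hI : 0 < I.im := by simp
  have hAI : 0 < (A * I).im := by simpa using hΦ.pos
  refine (tendsto_iff_ultrafilter _ _ _).2 fun f hf => ?_
  replace ht := ht.mono_left hf
  have hself := hh.eventually_isHoloSelfMap_rescale ht
  have hgI := hh.tendsto_mul_I_div_im hΦ ht
  obtain ⟨G, hG, hconv⟩ := exists_isHoloSelfMap_tendsto hself hI hI hgI
  have hGI : G I = I := tendsto_nhds_unique (hconv I hI) hgI
  have hGAI : G (A * I) = A * I := by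
    have hcomp := (IsHoloSelfMap.tendstoLocallyUniformlyOn hself hconv).tendsto_comp
      (hG.1.continuousOn _ hAI) hAI (tendsto_nhdsWithin_iff.2 ⟨hΦ.tendsto_mul_I_div ht, ?_⟩)
    · refine tendsto_nhds_unique hcomp ((hgI.const_mul (A : ℂ)).congr' ?_)
      filter_upwards [ht.eventually_gt_atTop 0] with i hti
      rw [mul_div_cancel₀ _ (ofReal_ne_zero.2 hti.ne'), hh.2 _ (by simpa), mul_div_assoc]
    · exact (hΦ.tendsto_mul_I_div ht).eventually_mem (isOpen_upperHalfPlaneSet.mem_nhds hAI)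
  have hne : A * I ≠ I := fun heq => hΦ.2.2.ne' (by simpa using congrArg im heq)
  have hid := hG.eqOn_id_of_two_fixedPoints hAI hI hne hGAI hGI hζ₀
  simpa [hid] using hconv ζ₀ hζ₀

theorem tendsto_rescale_comp [l.NeBot] (hh : IsValironMap Φ A h) (hΦ : IsHyperbolicSelfMap Φ A)
    (ht : Tendsto t l atTop) (hζ₀ : 0 < ζ₀.im) (hζ : Tendsto ζ l (𝓝 ζ₀)) :
    Tendsto (fun i => h (t i * ζ i) / (h (t i * I)).im) l (𝓝 ζ₀) :=
  (IsHoloSelfMap.tendstoLocallyUniformlyOn (g := id) (hh.eventually_isHoloSelfMap_rescale ht)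
    fun _ hw => hh.tendsto_rescale hΦ ht hw).tendsto_comp continuousWithinAt_id hζ₀
    (tendsto_nhdsWithin_iff.2
      ⟨hζ, hζ.eventually_mem (isOpen_upperHalfPlaneSet.mem_nhds hζ₀)⟩)

theorem tendsto_map_div_self (hh : IsValironMap Φ A h) (hΦ : IsHyperbolicSelfMap Φ A)
    (hz : IsNontangential l z t) (ht : Tendsto t l atTop) :
    Tendsto (fun i => h (z i) / z i * (t i / (h (t i * I)).im : ℝ)) l (𝓝 1) := by
  refine (tendsto_iff_ultrafilter _ _ _).2 fun f hf => ?_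
  replace ht := ht.mono_left hf
  have ht₀ := ht.eventually_gt_atTop 0
  obtain ⟨ζ₀, hζ₀, hζ⟩ := (hz.mono hf).exists_tendsto_div ht₀
  have hne : ζ₀ ≠ 0 := fun h0 => hζ₀.ne' (by simp [h0])
  have hlim := (hh.tendsto_rescale_comp hΦ ht hζ₀ hζ).div hζ hne
  rw [div_self hne] at hlim
  refine hlim.congr' ?_
  filter_upwards [ht₀] with i hti
  have hti' : (t i : ℂ) ≠ 0 := ofReal_ne_zero.2 hti.ne'
  simp only [Pi.div_apply, mul_div_cancel₀ _ hti']
  push_cast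
  field_simp

end IsValironMap

end Rigidity

/-! ### Convergence of the renormalized orbits -/

theorem tauMap_eq_sub (w z : ℂ) : tauMap w z = z / w.im - (w.re / w.im : ℝ) := by
  rw [tauMap, sub_div, ofReal_div]

theorem div_im_eq_tauMap_add {A : ℝ} (hA : A ≠ 1) (w z : ℂ) :
    z / w.im = tauMap w z + ((A - 1) * (w.re / w.im) : ℝ) / ((A : ℂ) - 1) := by
  have hA' : (A : ℂ) - 1 ≠ 0 := sub_ne_zero.2 (mod_cast hA)
  rw [tauMap_eq_sub]
  push_cast
  rw [mul_div_cancel_left₀ _ hA', sub_add_cancel]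

theorem IsHoloSelfMap.tauMap_comp {f : ℂ → ℂ} {w : ℂ} (hf : IsHoloSelfMap f) (hw : 0 < w.im) :
    IsHoloSelfMap fun z => tauMap w (f z) := by
  have heq : (fun z => tauMap w (f z)) = fun z => f z / w.im - (w.re / w.im : ℝ) :=
    funext fun z => tauMap_eq_sub w (f z)
  rw [heq]
  exact (hf.div_ofReal hw).sub_ofReal _

theorem arg_div_ofReal {r : ℝ} (hr : 0 < r) (z : ℂ) : (z / r).arg = z.arg := by
  rw [div_eq_inv_mul, ← ofReal_inv, arg_real_mul z (inv_pos.2 hr)]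

theorem continuousAt_arg_of_im_pos {z : ℂ} (hz : 0 < z.im) : ContinuousAt arg z :=
  continuousAt_arg (Or.inr hz.ne')

namespace IsValironMap

variable {Φ h : ℂ → ℂ} {A : ℝ} {z w : ℂ}

/-- The iterates converge to `h` after division by `A ^ n * t n / Im h (t n * I)`, where
`t n = Im Φ^[n] I`. -/
theorem exists_tendsto_iterate_div (hh : IsValironMap Φ A h) (hΦ : IsHyperbolicSelfMap Φ A) :
    ∃ r : ℕ → ℝ, (∀ n, 0 < r n) ∧
      ∀ z : ℂ, 0 < z.im → Tendsto (fun n => Φ^[n] z / r n) atTop (𝓝 (h z)) := by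
  have hI : 0 < I.im := by simp
  set t : ℕ → ℝ := fun n => (Φ^[n] I).im
  have ht : ∀ n, 0 < t n := hΦ.iterate_im_pos hI
  have hht : ∀ n, 0 < (h (t n * I)).im := fun n => hh.im_pos (by simpa using ht n)
  refine ⟨fun n => A ^ n * t n / (h (t n * I)).im, fun n => ?_, fun z hz => ?_⟩
  · exact div_pos (mul_pos (pow_pos hΦ.pos n) (ht n)) (hht n)
  have hlim : Tendsto (fun n => h (Φ^[n] z) / Φ^[n] z * (t n / (h (t n * I)).im : ℝ)) atTop
      (𝓝 1) :=
    hh.tendsto_map_div_self hΦ (hΦ.isNontangential_iterate hz hI) (hΦ.tendsto_iterate_im hI)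
  have hinv := (hlim.inv₀ one_ne_zero).mul_const (h z)
  rw [inv_one, one_mul] at hinv
  refine hinv.congr fun n => ?_
  have hne : h z ≠ 0 := hh.ne_zero hz
  rw [hh.map_iterate hΦ.1 hz]
  push_cast
  simp only [mul_inv, inv_div]
  field_simp

theorem tendsto_iterate_div_im (hh : IsValironMap Φ A h) (hΦ : IsHyperbolicSelfMap Φ A)
    (hz : 0 < z.im) (hw : 0 < w.im) :
    Tendsto (fun n => Φ^[n] z / (Φ^[n] w).im) atTop (𝓝 (h z / (h w).im)) := by
  obtain ⟨r, hr, hlim⟩ := hh.exists_tendsto_iterate_div hΦ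
  have him := (continuous_ofReal.tendsto _).comp ((continuous_im.tendsto _).comp (hlim w hw))
  refine ((hlim z hz).div him (ofReal_ne_zero.2 (hh.im_pos hw).ne')).congr fun n => ?_
  simp only [Pi.div_apply, Function.comp_apply, div_ofReal_im, ofReal_div]
  exact div_div_div_cancel_right₀ (ofReal_ne_zero.2 (hr n).ne') _ _

theorem tendsto_arg_iterate (hh : IsValironMap Φ A h) (hΦ : IsHyperbolicSelfMap Φ A)
    (hz : 0 < z.im) : Tendsto (fun n => (Φ^[n] z).arg) atTop (𝓝 (h z).arg) := by
  obtain ⟨r, hr, hlim⟩ := hh.exists_tendsto_iterate_div hΦ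
  refine ((continuousAt_arg_of_im_pos (hh.im_pos hz)).tendsto.comp (hlim z hz)).congr fun n => ?_
  exact arg_div_ofReal (hr n) _

theorem tendsto_iterate_re_sub_div_im (hh : IsValironMap Φ A h) (hΦ : IsHyperbolicSelfMap Φ A)
    (hz : 0 < z.im) :
    Tendsto (fun n => ((Φ^[n + 1] z).re - (Φ^[n] z).re) / (Φ^[n] z).im) atTop
      (𝓝 ((A - 1) * ((h z).re / (h z).im))) := by
  have hsub := (hh.tendsto_iterate_div_im hΦ (hΦ.1.im_pos hz) hz).sub
    (hh.tendsto_iterate_div_im hΦ hz hz)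
  have hre := (continuous_re.tendsto _).comp hsub
  rw [hh.2 z hz, sub_re, div_ofReal_re, div_ofReal_re, re_ofReal_mul, mul_div_assoc, ← sub_one_mul]
    at hre
  refine hre.congr fun n => ?_
  rw [Function.comp_apply, sub_re, div_ofReal_re, div_ofReal_re, ← sub_div,
    Function.iterate_succ_apply]

theorem tendstoLocallyUniformlyOn_renormIter (hh : IsValironMap Φ A h)
    (hΦ : IsHyperbolicSelfMap Φ A) (hw : 0 < w.im) :
    TendstoLocallyUniformlyOn (renormIter Φ w) (fun z => tauMap (h w) (h z)) atTop
      upperHalfPlaneSet := by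
  refine IsHoloSelfMap.tendstoLocallyUniformlyOn
    (.of_forall fun n => (hΦ.1.iterate n).tauMap_comp (hΦ.iterate_im_pos hw n)) fun z hz => ?_
  have hre := (continuous_ofReal.tendsto _).comp
    ((continuous_re.tendsto _).comp (hh.tendsto_iterate_div_im hΦ hw hw))
  rw [div_ofReal_re] at hre
  rw [tauMap_eq_sub]
  refine ((hh.tendsto_iterate_div_im hΦ hz hw).sub hre).congr fun n => ?_
  simp only [Function.comp_apply, div_ofReal_re, renormIter, tauMap_eq_sub]

end IsValironMap

/-! ### Arguments and semi-conformality -/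

theorem arg_mem_Ioo_of_im_pos {z : ℂ} (hz : 0 < z.im) : z.arg ∈ Ioo 0 Real.pi := by
  refine ⟨lt_of_le_of_ne (arg_nonneg_iff.2 hz.le) fun h => ?_, arg_lt_pi_iff.2 (Or.inr hz.ne')⟩
  exact hz.ne' (arg_eq_zero_iff.1 h.symm).2

theorem cot_arg {z : ℂ} (hz : 0 < z.im) : Real.cot z.arg = z.re / z.im := by
  have hne : z ≠ 0 := fun h0 => hz.ne' (by simp [h0])
  have := norm_ne_zero_iff.2 hne
  rw [Real.cot_eq_cos_div_sin, cos_arg hne, sin_arg]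
  field_simp

theorem exists_im_pos_arg_eq {α : ℝ} (hα : α ∈ Ioo 0 Real.pi) :
    ∃ ζ : ℂ, 0 < ζ.im ∧ ζ.arg = α := by
  refine ⟨exp (α * I), ?_, ?_⟩
  · rw [exp_ofReal_mul_I_im]
    exact Real.sin_pos_of_mem_Ioo hα
  · rw [exp_mul_I, arg_cos_add_sin_mul_I ⟨by linarith [hα.1, Real.pi_pos], hα.2.le⟩]

theorem norm_le_inv_sin_mul_im_of_mem_sectorAt {δ : ℝ} {z : ℂ} (hδ : 0 < δ)
    (hz : z ∈ sectorAt δ) : ‖z‖ ≤ (Real.sin δ)⁻¹ * z.im := by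
  have hδπ : δ < Real.pi / 2 := sub_pos.1 ((abs_nonneg _).trans_lt hz.2)
  have hsin : 0 < Real.sin δ := Real.sin_pos_of_pos_of_lt_pi hδ (by linarith)
  have hle : Real.sin δ ≤ Real.sin z.arg := by
    rw [← Real.cos_pi_div_two_sub, ← Real.cos_sub_pi_div_two, ← Real.cos_abs (z.arg - _)]
    exact Real.cos_le_cos_of_nonneg_of_le_pi (abs_nonneg _) (by linarith) hz.2.le
  rw [inv_mul_eq_div, le_div_iff₀ hsin]
  calc ‖z‖ * Real.sin δ ≤ ‖z‖ * Real.sin z.arg := by gcongr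
    _ = z.im := norm_mul_sin_arg z

theorem isNontangential_sectorAt {δ : ℝ} (hδ : 0 < δ) (l : Filter ℂ) :
    IsNontangential (l ⊓ 𝓟 (sectorAt δ)) id fun z => ‖z‖ := by
  refine ⟨max (Real.sin δ)⁻¹ 1, by positivity, ?_⟩
  filter_upwards [mem_inf_of_right (mem_principal_self _)] with z hz
  exact ⟨le_mul_of_one_le_left (norm_nonneg z) (le_max_right _ _),
    (norm_le_inv_sin_mul_im_of_mem_sectorAt hδ hz).trans
      (mul_le_mul_of_nonneg_right (le_max_left _ _) hz.1.le)⟩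

theorem exists_tendsto_mem_Ico {ι : Type*} {l : Filter ι} {y : ℕ → ℝ} {t : ι → ℝ}
    (hy : Monotone y) (hy' : Tendsto y atTop atTop) (ht : Tendsto t l atTop) :
    ∃ n : ι → ℕ, Tendsto n l atTop ∧ ∀ᶠ i in l, t i ∈ Ico (y (n i)) (y (n i + 1)) := by
  have hexists : ∀ s, y 0 ≤ s → ∃ n, s ∈ Ico (y n) (y (n + 1)) := fun s hs => by
    have hcover := iUnion_Ico_map_succ_eq_Ici (fun a => hy bot_le)
      (not_bddAbove_of_tendsto_atTop hy')
    exact mem_iUnion.1 (hcover.ge hs)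
  choose! n hn using hexists
  have hmem : ∀ᶠ i in l, t i ∈ Ico (y (n (t i))) (y (n (t i) + 1)) :=
    (ht.eventually_ge_atTop (y 0)).mono fun i hi => hn _ hi
  refine ⟨fun i => n (t i), tendsto_atTop.2 fun N => ?_, hmem⟩
  filter_upwards [hmem, ht.eventually_ge_atTop (y N)] with i hi hN
  exact Nat.lt_succ_iff.1 (hy.reflect_lt (hN.trans_lt hi.2))

namespace IsValironMap

variable {Φ h : ℂ → ℂ} {A : ℝ}

theorem tendsto_arg_mul (hh : IsValironMap Φ A h) (hΦ : IsHyperbolicSelfMap Φ A) {ζ : ℂ}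
    (hζ : 0 < ζ.im) : Tendsto (fun t : ℝ => (h (t * ζ)).arg) atTop (𝓝 ζ.arg) := by
  refine ((continuousAt_arg_of_im_pos hζ).tendsto.comp
    (hh.tendsto_rescale hΦ tendsto_id hζ)).congr' ?_
  filter_upwards [eventually_gt_atTop 0] with t ht
  exact arg_div_ofReal (hh.im_pos (by simpa)) _

theorem continuousOn_arg (hh : IsValironMap Φ A h) :
    ContinuousOn (fun z => (h z).arg) upperHalfPlaneSet :=
  ContinuousOn.comp (t := upperHalfPlaneSet)
    (fun _ hz => (continuousAt_arg_of_im_pos hz).continuousWithinAt) hh.1.1.continuousOn hh.1.2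

theorem exists_arg_map_eq (hh : IsValironMap Φ A h) (hΦ : IsHyperbolicSelfMap Φ A) {α : ℝ}
    (hα : α ∈ Ioo 0 Real.pi) : ∃ z ∈ upperHalfPlaneSet, (h z).arg = α := by
  obtain ⟨a, ha, haα⟩ := exists_between hα.1
  obtain ⟨b, hαb, hb⟩ := exists_between hα.2
  obtain ⟨ζ, hζ, rfl⟩ := exists_im_pos_arg_eq ⟨ha, haα.trans hα.2⟩
  obtain ⟨ξ, hξ, rfl⟩ := exists_im_pos_arg_eq ⟨hα.1.trans hαb, hb⟩
  obtain ⟨t, ht, htζ, htξ⟩ := ((eventually_gt_atTop 0).and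
    (((hh.tendsto_arg_mul hΦ hζ).eventually_lt_const haα).and
      ((hh.tendsto_arg_mul hΦ hξ).eventually_const_lt hαb))).exists
  have hconn : IsPreconnected upperHalfPlaneSet := (convex_halfSpace_im_gt 0).isPreconnected
  exact hconn.intermediate_value (a := t * ζ) (b := t * ξ) (by simp [ht, hζ]) (by simp [ht, hξ])
    hh.continuousOn_arg ⟨htζ.le, htξ.le⟩

/-- A nontangential family stays within bounded hyperbolic distance of an orbit, and `h` is
multiplied by `A` at each step of the orbit. -/
theorem tendsto_im_atTop (hh : IsValironMap Φ A h) (hΦ : IsHyperbolicSelfMap Φ A) {ι : Type*}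
    {l : Filter ι} {z : ι → ℂ} {t : ι → ℝ} (hz : IsNontangential l z t)
    (ht : Tendsto t l atTop) : Tendsto (fun i => (h (z i)).im) l atTop := by
  have hI : 0 < I.im := by simp
  have ht₀ := ht.eventually_gt_atTop 0
  set y : ℕ → ℝ := fun n => (Φ^[n] I).im
  have hy : ∀ n, 0 < y n := hΦ.iterate_im_pos hI
  obtain ⟨n, hn, hmem⟩ :=
    exists_tendsto_mem_Ico (hΦ.monotone_iterate_im hI) (hΦ.tendsto_iterate_im hI) ht
  have hratio : ∀ m, y (m + 1) ≤ (hypSq (Φ I) I + 2) * y m := fun m =>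
    im_le_of_hypSq_le (hΦ.iterate_im_pos hI _) (hy m)
      ((hΦ.1.iterate m).hypSq_map_le (hΦ.1.im_pos hI) hI)
  have horbit : IsNontangential l (fun i => Φ^[n i] I) t :=
    ((hΦ.isNontangential_iterate hI hI).comp_tendsto hn).of_scale_le (.of_forall fun i => hy _)
      (hmem.mono fun i hi => hi.1) (hmem.mono fun i hi => hi.2.le.trans (hratio _))
  obtain ⟨S, hS⟩ := hz.exists_hypSq_le horbit ht₀
  obtain ⟨K, hK⟩ := hz.exists_norm_le_mul_im ht₀
  have hpow : Tendsto (fun i => A ^ n i * (h I).im) l atTop :=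
    ((tendsto_pow_atTop_atTop_of_one_lt hΦ.2.2).comp hn).atTop_mul_const (hh.im_pos hI)
  refine tendsto_atTop_mono' l ?_ (hpow.atTop_div_const (show 0 < |S| + 2 by positivity))
  filter_upwards [hS, hK] with i hSi ⟨hzi, _⟩
  have hle := im_le_of_hypSq_le (hh.im_pos (hy _)) (hh.im_pos hzi)
    ((hh.1.hypSq_map_le (hy _) hzi).trans (hSi.trans (le_abs_self S)))
  rw [hh.map_iterate hΦ.1 hI, ← ofReal_pow, im_ofReal_mul] at hle
  exact (div_le_iff₀' (by positivity)).2 hle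

theorem semiConformalAtInfty (hh : IsValironMap Φ A h) (hΦ : IsHyperbolicSelfMap Φ A) :
    SemiConformalAtInfty h := by
  have hnorm (δ : ℝ) : Tendsto (fun z : ℂ => ‖z‖) (Bornology.cobounded ℂ ⊓ 𝓟 (sectorAt δ)) atTop :=
    tendsto_norm_cobounded_atTop.mono_left inf_le_left
  refine ⟨fun δ hδ => ?_, fun δ hδ => ?_⟩
  · have him := hh.tendsto_im_atTop hΦ (isNontangential_sectorAt hδ _) (hnorm δ)
    exact tendsto_norm_atTop_iff_cobounded.1
      (tendsto_atTop_mono (fun z => (le_abs_self _).trans (abs_im_le_norm _)) him)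
  · have hlim := hh.tendsto_map_div_self hΦ (isNontangential_sectorAt hδ _) (hnorm δ)
    have harg := (continuousAt_arg one_mem_slitPlane).tendsto.comp hlim
    rw [arg_one] at harg
    refine harg.congr' ?_
    filter_upwards [(hnorm δ).eventually_gt_atTop 0] with z hz
    exact arg_mul_real (div_pos hz (hh.im_pos (by simpa using hz))) _

theorem continuousOn_re_div_im (hh : IsValironMap Φ A h) :
    ContinuousOn (fun z => (h z).re / (h z).im) upperHalfPlaneSet :=
  (continuous_re.comp_continuousOn hh.1.1.continuousOn).div
    (continuous_im.comp_continuousOn hh.1.1.continuousOn) fun _ hz => (hh.im_pos hz).ne'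

theorem tauMap_map {w z : ℂ} (hh : IsValironMap Φ A h) (hz : 0 < z.im) :
    tauMap (h w) (h (Φ z)) =
      A * tauMap (h w) (h z) + ((A - 1) * ((h w).re / (h w).im) : ℝ) := by
  rw [tauMap_eq_sub, tauMap_eq_sub, hh.2 z hz]
  push_cast
  ring

end IsValironMap

theorem mainTheorem5 (Φ : ℂ → ℂ) (A : ℝ) (hΦ : IsHyperbolicSelfMap Φ A) :
    ∃ θ b : ℂ → ℝ,
      (∀ z₀ ∈ UpperHalfPlane.upperHalfPlaneSet,
        θ z₀ ∈ Set.Ioo 0 Real.pi ∧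
        Filter.Tendsto (fun n : ℕ => (Φ^[n] z₀).arg) Filter.atTop (nhds (θ z₀)) ∧
        Filter.Tendsto
          (fun n : ℕ => ((Φ^[n + 1] z₀).re - (Φ^[n] z₀).re) / (Φ^[n] z₀).im)
          Filter.atTop (nhds (b z₀)) ∧
        b z₀ = (A - 1) * Real.cot (θ z₀)) ∧
      ContinuousOn b UpperHalfPlane.upperHalfPlaneSet ∧
      (∀ z₀ ∈ UpperHalfPlane.upperHalfPlaneSet,
        ∃ σ σhat : ℂ → ℂ,
          IsHoloSelfMap σ ∧
          TendstoLocallyUniformlyOn (renormIter Φ z₀) σ Filter.atTop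
            UpperHalfPlane.upperHalfPlaneSet ∧
          (∀ z ∈ UpperHalfPlane.upperHalfPlaneSet,
            σ (Φ z) = (A : ℂ) * σ z + (b z₀ : ℂ)) ∧
          (∀ z, σhat z = σ z + (b z₀ : ℂ) / ((A : ℂ) - 1)) ∧
          IsHoloSelfMap σhat ∧
          SemiConformalAtInfty σhat ∧
          (∀ z ∈ UpperHalfPlane.upperHalfPlaneSet, σhat (Φ z) = (A : ℂ) * σhat z) ∧
          (∀ z ∈ UpperHalfPlane.upperHalfPlaneSet, θ z = (σhat z).arg)) ∧
      (∀ α ∈ Set.Ioo 0 Real.pi,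
        ∃ z₀ ∈ UpperHalfPlane.upperHalfPlaneSet, θ z₀ = α) := by
  obtain ⟨h, hh⟩ := hΦ.exists_isValironMap
  refine ⟨fun z => (h z).arg, fun z => (A - 1) * ((h z).re / (h z).im), fun z hz => ?_,
    hh.continuousOn_re_div_im.const_mul _, fun w hw => ?_, fun α hα => hh.exists_arg_map_eq hΦ hα⟩
  · exact ⟨arg_mem_Ioo_of_im_pos (hh.im_pos hz), hh.tendsto_arg_iterate hΦ hz,
      hh.tendsto_iterate_re_sub_div_im hΦ hz, by rw [cot_arg (hh.im_pos hz)]⟩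
  · have hhw : 0 < (h w).im := hh.im_pos hw
    have hhat : IsValironMap Φ A fun z => h z / (h w).im := hh.div_ofReal hhw
    exact ⟨fun z => tauMap (h w) (h z), fun z => h z / (h w).im, hh.1.tauMap_comp hhw,
      hh.tendstoLocallyUniformlyOn_renormIter hΦ hw, fun z hz => hh.tauMap_map hz,
      fun z => div_im_eq_tauMap_add hΦ.2.2.ne' (h w) (h z), hhat.1, hhat.semiConformalAtInfty hΦ,
      hhat.2, fun z _ => (arg_div_ofReal hhw _).symm⟩
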